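/- Let $M,N\ge 1$ be integers. For $1\le i\le M$ let $l_i>0$, let $J_i=[-l_i/2,\,l_i/2]$ be the closed interval of length $l_i$ centered at $0$, and let $L_i:\mathbb{R}^N\to\mathbb{R}$ be a surjective linear map. Assume that the tuple $(L_i,l_i)_{i=1}^M$ is admissible, meaning that for every $m\in\{1,\dots,M\}$ there exists $x\in\mathbb{R}^N$ with $|L_i(x)|\le l_i$ for all $i$ and $|L_m(x)|=l_m$. For $\vec t\in\mathbb{R}^M$ set $$\Psi(\vec t)=\int_{\mathbb{R}^N}\prod_{i=1}^M 1_{J_i+t_i}(L_i(y))\,dy\in[0,\infty].$$ Then for every $\vec t\in\mathbb{R}^M$ one has $\Psi(\vec t)\le\Psi(\vec 0)$. If $\Psi(\vec 0)<\infty$ (equivalently, if $y=0$ is the only $y\in\mathbb{R}^N$ with $L_i(y)=0$ for all $i$), then $\Psi(\vec t)=\Psi(\vec 0)$ if and only if there exists $v\in\mathbb{R}^N$ with $L_i(v)=t_i$ for all $i$. The "if" direction of this equivalence also holds when $\Psi(\vec 0)=\infty$. -/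

import Mathlib

open MeasureTheory
open scoped ENNReal

/-- The closed interval centered at `0` of length `l` (used for `l > 0`). -/
def centeredInterval (l : ℝ) : Set ℝ := Set.Icc (-(l / 2)) (l / 2)

/-- The translate `J + s` of a set `J` of real numbers. -/
def translateSet (J : Set ℝ) (s : ℝ) : Set ℝ := (fun x => x + s) '' J

/-- `Ψ(t) = ∫_{ℝ^N} ∏ i, 1_{J_i + t_i}(L_i y) dy`, where `J_i` is the closed interval of length
`l i` centered at `0`. The integrand is nonnegative, and the integral (with respect to Lebesgue
measure) is taken in `[0, ∞]`. -/
noncomputable def Psi {M N : ℕ} (L : Fin M → (EuclideanSpace ℝ (Fin N) →ₗ[ℝ] ℝ))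
    (l : Fin M → ℝ) (t : Fin M → ℝ) : ℝ≥0∞ :=
  ∫⁻ y : EuclideanSpace ℝ (Fin N),
    ∏ i, (translateSet (centeredInterval (l i)) (t i)).indicator (fun _ => (1 : ℝ≥0∞)) (L i y)

/-- `K_l = {x ∈ ℝ^N : |L_i x| ≤ l_i for all i}`. -/
def symmetricBody {M N : ℕ} (L : Fin M → (EuclideanSpace ℝ (Fin N) →ₗ[ℝ] ℝ))
    (l : Fin M → ℝ) : Set (EuclideanSpace ℝ (Fin N)) :=
  {x | ∀ i, |L i x| ≤ l i}

/-- The tuple `(L_i, l_i)` is admissible: for every `m` there is `x ∈ K_l` with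
`|L_m x| = l_m`. -/
def IsAdmissibleTuple {M N : ℕ} (L : Fin M → (EuclideanSpace ℝ (Fin N) →ₗ[ℝ] ℝ))
    (l : Fin M → ℝ) : Prop :=
  ∀ m, ∃ x ∈ symmetricBody L l, |L m x| = l m

/-! `Psi L l t` is the volume of the slab intersection S_t = {|L_i y - t_i| ≤ l_i/2}. In a half
difference (x - y)/2 of points of S_t the shift t cancels, so it lies in S_0, and Brunn–Minkowski in
the form |A||B| ≤ |C|² gives |S_t| ≤ |S_0|. That inequality comes from midpoint Prékopa–Leindler,
proved on the line and carried to ℝⁿ by Fubini.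

For equality no classification of Brunn–Minkowski extremals is used. Fix m and let μ, σ be the
images of Lebesgue measure on S_t, S_0 under L_m - t_m and L_m. Cutting S_t by opposite half-spaces
gives Brunn–Minkowski bounds for μ against σ on half-lines. As the total masses agree and
admissibility gives σ full support in [-l_m/2, l_m/2], these bounds force μ to be symmetric
(`map_neg_eq_self_of_sq_le`, through the quantile comparison `le_of_midpoint_sq_le`). So L_m has
mean t_m on S_t for each m. The vector of these means lies in the range of y ↦ (L_i y)_i, which
yields v. -/

/-! ### Brunn–Minkowski on the line -/

theorem Real.volume_preimage_two_mul_sub (K : Set ℝ) (c : ℝ) :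
    2 * volume ((fun z : ℝ => 2 * z - c) ⁻¹' K) = volume K := by
  have h1 : (fun z : ℝ => 2 * z - c) ⁻¹' K = (fun z => 2 * z) ⁻¹' ((fun z => z + (-c)) ⁻¹' K) := rfl
  rw [h1, Real.volume_preimage_mul_left two_ne_zero, measure_preimage_add_right, ← mul_assoc,
    abs_of_pos (by norm_num), ← ENNReal.ofReal_ofNat 2, ← ENNReal.ofReal_mul (by norm_num)]
  norm_num

theorem Real.volume_add_le_of_isCompact {A B C : Set ℝ} (hA : IsCompact A) (hB : IsCompact B)
    (hA0 : A.Nonempty) (hB0 : B.Nonempty) (h : ∀ x ∈ A, ∀ y ∈ B, (x + y) / 2 ∈ C) :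
    volume A + volume B ≤ 2 * volume C := by
  obtain ⟨a, ha, ha'⟩ := hA.exists_isGreatest hA0
  obtain ⟨b, hb, hb'⟩ := hB.exists_isLeast hB0
  -- With a = max A and b = min B, the sets (A + b)/2 and (B + a)/2 lie in C and can meet only at (a
  -- + b)/2.
  set A' : Set ℝ := (fun z => 2 * z - b) ⁻¹' A
  set B' : Set ℝ := (fun z => 2 * z - a) ⁻¹' B
  have hB'm : MeasurableSet B' := (hB.measurableSet).preimage (by fun_prop)
  have hsub : A' ∪ B' ⊆ C := by
    rintro z (hz | hz)
    · simpa using h _ hz b hb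
    · simpa using h a ha _ hz
  have hinter : volume (A' ∩ B') = 0 := by
    refine measure_mono_null (t := {(a + b) / 2}) ?_ (by simp)
    rintro z ⟨hz1, hz2⟩
    have h1 : 2 * z - b ≤ a := ha' hz1
    have h2 : b ≤ 2 * z - a := hb' hz2
    simp only [Set.mem_singleton_iff]
    linarith
  calc volume A + volume B = 2 * (volume A' + volume B') := by
        rw [mul_add, Real.volume_preimage_two_mul_sub, Real.volume_preimage_two_mul_sub]
    _ = 2 * volume (A' ∪ B') := by rw [← measure_union_add_inter A' hB'm, hinter, add_zero]
    _ ≤ 2 * volume C := by gcongr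

theorem Real.volume_add_le {A B C : Set ℝ} (hA : MeasurableSet A) (hB : MeasurableSet B)
    (hA0 : A.Nonempty) (hB0 : B.Nonempty) (h : ∀ x ∈ A, ∀ y ∈ B, (x + y) / 2 ∈ C) :
    volume A + volume B ≤ 2 * volume C := by
  obtain ⟨a, ha⟩ := hA0
  obtain ⟨b, hb⟩ := hB0
  rw [hA.measure_eq_iSup_isCompact, hB.measure_eq_iSup_isCompact]
  simp only [iSup_and']
  refine ENNReal.biSup_add_biSup_le' ⟨∅, by simp⟩ ⟨∅, by simp⟩ ?_
  rintro K ⟨hK, hKc⟩ K' ⟨hK', hKc'⟩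
  -- The added points keep the inner compact sets nonempty.
  calc volume K + volume K' ≤ volume (K ∪ {a}) + volume (K' ∪ {b}) := by
        gcongr <;> exact Set.subset_union_left
    _ ≤ 2 * volume C := by
        refine Real.volume_add_le_of_isCompact (hKc.union isCompact_singleton)
          (hKc'.union isCompact_singleton) ⟨a, by simp⟩ ⟨b, by simp⟩ ?_
        intro x hx y hy
        exact h x (Set.union_subset hK (by simpa using ha) hx) y
          (Set.union_subset hK' (by simpa using hb) hy)

/-! ### Prékopa–Leindler and multiplicative Brunn–Minkowski -/

theorem lintegral_eq_lintegral_measure_ofReal_lt {f : ℝ → ℝ≥0∞} (hf : Measurable f)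
    (hf' : ∀ x, f x ≠ ∞) :
    ∫⁻ x, f x = ∫⁻ s in Set.Ioi (0 : ℝ), volume {x | ENNReal.ofReal s < f x} := by
  have h1 : ∀ x, f x = ENNReal.ofReal (f x).toReal := fun x => (ENNReal.ofReal_toReal (hf' x)).symm
  rw [lintegral_congr h1, lintegral_eq_lintegral_meas_lt volume
    (Filter.Eventually.of_forall fun x => ENNReal.toReal_nonneg) hf.ennreal_toReal.aemeasurable]
  refine setLIntegral_congr_fun measurableSet_Ioi fun s hs => ?_
  congr 1
  ext x
  exact (ENNReal.ofReal_lt_iff_lt_toReal (le_of_lt hs) (hf' x)).symm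

/-- Layer cake reduces this to superlevel sets. Equal suprema make those of f and g nonempty at the
same levels, as one-dimensional Brunn–Minkowski requires. -/
theorem lintegral_add_le_of_min_le {f g h : ℝ → ℝ≥0∞} (hf : Measurable f) (hg : Measurable g)
    (hh : Measurable h) (hf' : ∀ x, f x ≠ ∞) (hg' : ∀ x, g x ≠ ∞) (hh' : ∀ x, h x ≠ ∞)
    (hs : ⨆ x, f x = ⨆ x, g x) (H : ∀ x y, min (f x) (g y) ≤ h ((x + y) / 2)) :
    (∫⁻ x, f x) + ∫⁻ x, g x ≤ 2 * ∫⁻ x, h x := by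
  rw [lintegral_eq_lintegral_measure_ofReal_lt hf hf', lintegral_eq_lintegral_measure_ofReal_lt hg hg',
    lintegral_eq_lintegral_measure_ofReal_lt hh hh']
  have hm : ∀ k : ℝ → ℝ≥0∞, Measurable fun s : ℝ => volume {x | ENNReal.ofReal s < k x} := fun k =>
    Antitone.measurable fun s t hst => measure_mono fun x hx =>
      lt_of_le_of_lt (ENNReal.ofReal_le_ofReal hst) hx
  rw [← lintegral_add_left (hm f), ← lintegral_const_mul _ (hm h)]
  refine lintegral_mono fun s => ?_
  by_cases hne : ENNReal.ofReal s < ⨆ x, f x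
  · refine Real.volume_add_le (measurableSet_lt measurable_const hf)
      (measurableSet_lt measurable_const hg) (lt_iSup_iff.1 hne) (lt_iSup_iff.1 (hne.trans_eq hs)) ?_
    intro x hx y hy
    exact lt_of_lt_of_le (lt_min hx hy) (H x y)
  · have e1 : {x | ENNReal.ofReal s < f x} = ∅ := by
      rw [Set.eq_empty_iff_forall_notMem]
      exact fun x hx => hne (lt_iSup_iff.2 ⟨x, hx⟩)
    have e2 : {x | ENNReal.ofReal s < g x} = ∅ := by
      rw [Set.eq_empty_iff_forall_notMem]
      exact fun x hx => hne ((lt_iSup_iff.2 ⟨x, hx⟩).trans_eq hs.symm)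
    simp [e1, e2]

theorem ENNReal.mul_le_sq_of_add_le_two_mul {a b c : ℝ≥0∞} (h : a + b ≤ 2 * c) : a * b ≤ c ^ 2 := by
  rcases eq_or_ne c ∞ with rfl | hc
  · simp
  have hab : a + b ≠ ∞ := ne_top_of_le_ne_top (ENNReal.mul_ne_top (by simp) hc) h
  lift c to NNReal using hc
  lift a to NNReal using (ENNReal.add_ne_top.1 hab).1
  lift b to NNReal using (ENNReal.add_ne_top.1 hab).2
  norm_cast at h ⊢
  rw [← NNReal.coe_le_coe] at h ⊢
  push_cast at h ⊢
  nlinarith [sq_nonneg ((a : ℝ) - b), a.2, b.2, c.2, NNReal.coe_nonneg a, NNReal.coe_nonneg b]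

/-- **Prékopa–Leindler inequality** (midpoint form) on the line, for bounded functions. -/
theorem prekopaLeindler_real_of_bounded {f g h : ℝ → ℝ≥0∞} (hf : Measurable f) (hg : Measurable g)
    (hh : Measurable h) {M : ℝ≥0∞} (hM : M ≠ ∞) (hfM : ∀ x, f x ≤ M) (hgM : ∀ x, g x ≤ M)
    (H : ∀ x y, f x * g y ≤ h ((x + y) / 2) ^ 2) :
    (∫⁻ x, f x) * ∫⁻ x, g x ≤ (∫⁻ x, h x) ^ 2 := by
  set α := ⨆ x, f x with hα
  set β := ⨆ x, g x with hβ
  have hαt : α ≠ ∞ := ne_top_of_le_ne_top hM (iSup_le hfM)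
  have hβt : β ≠ ∞ := ne_top_of_le_ne_top hM (iSup_le hgM)
  rcases eq_or_ne α 0 with h0 | hα0
  · have : f = 0 := funext fun x => by simpa using ENNReal.iSup_eq_zero.1 h0 x
    simp [this]
  rcases eq_or_ne β 0 with h0 | hβ0
  · have : g = 0 := funext fun x => by simpa using ENNReal.iSup_eq_zero.1 h0 x
    simp [this]
  have hαp := ENNReal.toReal_pos hα0 hαt
  have hβp := ENNReal.toReal_pos hβ0 hβt
  -- Scaling f by r and g by 1/r equalises the suprema and leaves the product f x * g y unchanged.
  set r : ℝ := Real.sqrt (β.toReal / α.toReal) with hr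
  have hrp : 0 < r := Real.sqrt_pos.2 (by positivity)
  set c : ℝ≥0∞ := ENNReal.ofReal r with hc
  set d : ℝ≥0∞ := ENNReal.ofReal r⁻¹ with hd
  have hcd : c * d = 1 := by
    rw [hc, hd, ← ENNReal.ofReal_mul hrp.le, mul_inv_cancel₀ hrp.ne', ENNReal.ofReal_one]
  have hsup : c * α = d * β := by
    rw [← ENNReal.ofReal_toReal hαt, ← ENNReal.ofReal_toReal hβt, hc, hd,
      ← ENNReal.ofReal_mul hrp.le, ← ENNReal.ofReal_mul (inv_nonneg.2 hrp.le)]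
    congr 1
    have h2 : r ^ 2 = β.toReal / α.toReal := Real.sq_sqrt (by positivity)
    rw [eq_div_iff hαp.ne'] at h2
    field_simp
    linarith
  have hct : c ≠ ∞ := ENNReal.ofReal_ne_top
  have hdt : d ≠ ∞ := ENNReal.ofReal_ne_top
  -- Truncating h at M makes it finite; the hypothesis survives because f x * g y ≤ M².
  have key : (∫⁻ x, c * f x) + ∫⁻ x, d * g x ≤ 2 * ∫⁻ x, min (h x) M := by
    refine lintegral_add_le_of_min_le (hf.const_mul _) (hg.const_mul _) (hh.min measurable_const)
      (fun x => ENNReal.mul_ne_top hct (ne_top_of_le_ne_top hM (hfM x)))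
      (fun x => ENNReal.mul_ne_top hdt (ne_top_of_le_ne_top hM (hgM x)))
      (fun x => ne_top_of_le_ne_top hM (min_le_right _ _))
      (by rw [← ENNReal.mul_iSup, ← ENNReal.mul_iSup]; exact hsup) ?_
    intro x y
    rw [← ENNReal.pow_le_pow_left_iff two_ne_zero]
    calc min (c * f x) (d * g y) ^ 2 ≤ (c * f x) * (d * g y) := by
          rw [sq]; exact mul_le_mul' (min_le_left _ _) (min_le_right _ _)
      _ = (c * d) * (f x * g y) := by ring
      _ = f x * g y := by rw [hcd, one_mul]
      _ ≤ min (h ((x + y) / 2)) M ^ 2 := by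
          rcases min_choice (h ((x + y) / 2)) M with e | e <;> rw [e]
          · exact H x y
          · rw [sq]; exact mul_le_mul' (hfM x) (hgM y)
  rw [lintegral_const_mul _ hf, lintegral_const_mul _ hg] at key
  have := ENNReal.mul_le_sq_of_add_le_two_mul key
  calc (∫⁻ x, f x) * ∫⁻ x, g x = (c * d) * ((∫⁻ x, f x) * ∫⁻ x, g x) := by rw [hcd, one_mul]
    _ = (c * ∫⁻ x, f x) * (d * ∫⁻ x, g x) := by ring
    _ ≤ (∫⁻ x, min (h x) M) ^ 2 := this
    _ ≤ (∫⁻ x, h x) ^ 2 := by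
        gcongr
        exact min_le_left _ _

theorem ENNReal.iSup_min_natCast (a : ℝ≥0∞) : ⨆ n : ℕ, min a (n : ℝ≥0∞) = a := by
  rw [← inf_iSup_eq, ENNReal.iSup_natCast, inf_top_eq]

theorem lintegral_eq_iSup_lintegral_min {α : Type*} [MeasurableSpace α] {μ : Measure α}
    {f : α → ℝ≥0∞} (hf : Measurable f) :
    ∫⁻ x, f x ∂μ = ⨆ n : ℕ, ∫⁻ x, min (f x) (n : ℝ≥0∞) ∂μ := by
  rw [← lintegral_iSup (fun n => hf.min measurable_const)
    (fun m n hmn x => min_le_min_left _ (Nat.cast_le.2 hmn))]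
  exact lintegral_congr fun x => (ENNReal.iSup_min_natCast _).symm

/-- **Prékopa–Leindler inequality** (midpoint form) on the line. -/
theorem prekopaLeindler_real {f g h : ℝ → ℝ≥0∞} (hf : Measurable f) (hg : Measurable g)
    (hh : Measurable h) (H : ∀ x y, f x * g y ≤ h ((x + y) / 2) ^ 2) :
    (∫⁻ x, f x) * ∫⁻ x, g x ≤ (∫⁻ x, h x) ^ 2 := by
  rw [lintegral_eq_iSup_lintegral_min hf, lintegral_eq_iSup_lintegral_min hg, ENNReal.iSup_mul]
  refine iSup_le fun m => ?_
  rw [ENNReal.mul_iSup]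
  refine iSup_le fun n => ?_
  refine prekopaLeindler_real_of_bounded (M := (m : ℝ≥0∞) + n) (hf.min measurable_const)
    (hg.min measurable_const) hh (by simp) (fun x => (min_le_right _ _).trans le_self_add)
    (fun x => (min_le_right _ _).trans le_add_self) fun x y => ?_
  exact (mul_le_mul' (min_le_left _ _) (min_le_left _ _)).trans (H x y)

/-- **Prékopa–Leindler inequality** (midpoint form) on `ℝⁿ`. -/
theorem prekopaLeindler_pi {n : ℕ} {f g h : (Fin n → ℝ) → ℝ≥0∞} (hf : Measurable f)
    (hg : Measurable g) (hh : Measurable h)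
    (H : ∀ x y, f x * g y ≤ h ((2⁻¹ : ℝ) • (x + y)) ^ 2) :
    (∫⁻ x, f x) * ∫⁻ x, g x ≤ (∫⁻ x, h x) ^ 2 := by
  induction n with
  | zero =>
    rw [volume_pi, Measure.pi_of_empty _ 0, lintegral_dirac, lintegral_dirac, lintegral_dirac]
    convert H 0 0 using 3
  | succ n ih =>
    have mp := (volume_preserving_piFinSuccAbove (fun _ : Fin (n + 1) => ℝ) 0).symm
    set e := (MeasurableEquiv.piFinSuccAbove (fun _ : Fin (n + 1) => ℝ) 0).symm with he
    have hsplit : ∀ k : (Fin (n + 1) → ℝ) → ℝ≥0∞, Measurable k →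
        ∫⁻ x, k x = ∫⁻ s : ℝ, ∫⁻ z : Fin n → ℝ, k (e (s, z)) := by
      intro k hk
      rw [← mp.lintegral_comp hk, Measure.volume_eq_prod, lintegral_prod]
      exact (hk.comp e.measurable).aemeasurable
    have hmeas : ∀ k : (Fin (n + 1) → ℝ) → ℝ≥0∞, Measurable k →
        Measurable fun s : ℝ => ∫⁻ z : Fin n → ℝ, k (e (s, z)) := fun k hk =>
      Measurable.lintegral_prod_right' (f := fun p => k (e p)) (hk.comp e.measurable)
    have hsec : ∀ k : (Fin (n + 1) → ℝ) → ℝ≥0∞, Measurable k → ∀ s : ℝ,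
        Measurable fun z : Fin n → ℝ => k (e (s, z)) := fun k hk s =>
      hk.comp (e.measurable.comp measurable_prodMk_left)
    rw [hsplit f hf, hsplit g hg, hsplit h hh]
    refine prekopaLeindler_real (hmeas f hf) (hmeas g hg) (hmeas h hh) fun s t => ?_
    refine ih (hsec f hf s) (hsec g hg t) (hsec h hh _) fun z w => ?_
    convert H (e (s, z)) (e (t, w)) using 3
    ext i
    refine Fin.cases ?_ (fun j => ?_) i
    · simp [he, MeasurableEquiv.piFinSuccAbove]; ring
    · simp [he, MeasurableEquiv.piFinSuccAbove]; ring

/-- Multiplicative **Brunn–Minkowski inequality** for half the difference of two sets. -/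
theorem EuclideanSpace.volume_mul_le_of_half_sub_mem {N : ℕ} {A B C : Set (EuclideanSpace ℝ (Fin N))}
    (hA : MeasurableSet A) (hB : MeasurableSet B) (hC : MeasurableSet C)
    (H : ∀ x ∈ A, ∀ y ∈ B, (2⁻¹ : ℝ) • (x - y) ∈ C) :
    volume A * volume B ≤ volume C ^ 2 := by
  have mp := PiLp.volume_preserving_toLp (Fin N)
  have hm := mp.measurable
  have hmB := hB.neg
  rw [← Measure.measure_neg volume B, ← mp.measure_preimage hA.nullMeasurableSet,
    ← mp.measure_preimage hmB.nullMeasurableSet, ← mp.measure_preimage hC.nullMeasurableSet,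
    ← lintegral_indicator_one (hm hA), ← lintegral_indicator_one (hm hmB),
    ← lintegral_indicator_one (hm hC)]
  refine prekopaLeindler_pi (measurable_one.indicator (hm hA)) (measurable_one.indicator (hm hmB))
    (measurable_one.indicator (hm hC)) fun x y => ?_
  by_cases hx : WithLp.toLp 2 x ∈ A
  · by_cases hy : -WithLp.toLp 2 y ∈ B
    · have := H _ hx _ hy
      rw [sub_neg_eq_add, ← WithLp.toLp_add, ← WithLp.toLp_smul] at this
      simp only [Set.indicator, Set.mem_preimage, Set.mem_neg, hx, hy, this]
      simp
    · simp [Set.indicator, hy]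
  · simp [Set.indicator, hx]

/-! ### Comparison of quantiles -/

-- The level V(1 - e⁻ᵘ) leaves V e⁻ᵘ above it, so products of remaining masses become sums of
-- parameters. Since F need not be monotone, Q u is the largest point where F is at most that level.
open Filter Topology in
theorem exists_quantile {F : ℝ → ℝ} {h V : ℝ} (hh : 0 < h) (hV : 0 < V)
    (hF : Continuous F) (hF0 : F (-h) = 0) (hF1 : F h = V) (hFpos : ∀ x, -h < x → x ≤ h → 0 < F x) :
    ∃ Q : ℝ → ℝ, MonotoneOn Q (Set.Ici 0) ∧
      (∀ u, 0 ≤ u → Q u ∈ Set.Icc (-h) h ∧ F (Q u) = V * (1 - Real.exp (-u)) ∧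
        ∀ x ∈ Set.Icc (-h) h, F x ≤ V * (1 - Real.exp (-u)) → x ≤ Q u) ∧
      Tendsto Q (𝓝[>] 0) (𝓝 (-h)) := by
  have hex : ∀ u : ℝ, ∃ q, 0 ≤ u →
      IsGreatest (Set.Icc (-h) h ∩ F ⁻¹' Set.Iic (V * (1 - Real.exp (-u)))) q := by
    intro u
    by_cases hu : 0 ≤ u
    · have hne : (Set.Icc (-h) h ∩ F ⁻¹' Set.Iic (V * (1 - Real.exp (-u)))).Nonempty := by
        have : Real.exp (-u) ≤ 1 := Real.exp_le_one_iff.2 (by linarith)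
        refine ⟨-h, ⟨le_rfl, by linarith⟩, ?_⟩
        simp only [Set.mem_preimage, Set.mem_Iic, hF0]
        exact mul_nonneg hV.le (by linarith)
      obtain ⟨q, hq⟩ := (isCompact_Icc.inter_right (isClosed_Iic.preimage hF)).exists_isGreatest hne
      exact ⟨q, fun _ => hq⟩
    · exact ⟨0, fun h => absurd h hu⟩
  choose Q hQ using hex
  have hmono : MonotoneOn Q (Set.Ici 0) := by
    intro u hu v hv huv
    refine (hQ v hv).2 ⟨(hQ u hu).1.1, ?_⟩
    have h1 : F (Q u) ≤ V * (1 - Real.exp (-u)) := (hQ u hu).1.2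
    have h2 : Real.exp (-v) ≤ Real.exp (-u) := Real.exp_le_exp.2 (by linarith)
    simp only [Set.mem_preimage, Set.mem_Iic]
    nlinarith
  have hprop : ∀ u, 0 ≤ u → Q u ∈ Set.Icc (-h) h ∧ F (Q u) = V * (1 - Real.exp (-u)) ∧
      ∀ x ∈ Set.Icc (-h) h, F x ≤ V * (1 - Real.exp (-u)) → x ≤ Q u := by
    intro u hu
    refine ⟨(hQ u hu).1.1, le_antisymm (hQ u hu).1.2 ?_, fun x hx hx' => (hQ u hu).2 ⟨hx, hx'⟩⟩
    have he : Real.exp (-u) ≤ 1 := Real.exp_le_one_iff.2 (by linarith)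
    have he' := Real.exp_pos (-u)
    obtain ⟨x, hx, hx'⟩ : V * (1 - Real.exp (-u)) ∈ F '' Set.Icc (-h) h := by
      refine intermediate_value_Icc (by linarith) hF.continuousOn ⟨?_, ?_⟩
      · rw [hF0]; exact mul_nonneg hV.le (by linarith)
      · rw [hF1]; nlinarith
    have hxQ : x ≤ Q u := (hQ u hu).2 ⟨hx, hx'.le⟩
    by_contra! hlt
    obtain ⟨y, hy, hy'⟩ : V * (1 - Real.exp (-u)) ∈ F '' Set.Icc (Q u) h := by
      refine intermediate_value_Icc (hQ u hu).1.1.2 hF.continuousOn ⟨hlt.le, ?_⟩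
      rw [hF1]; nlinarith
    have hyQ : y ≤ Q u := (hQ u hu).2 ⟨⟨(hQ u hu).1.1.1.trans hy.1, hy.2⟩, hy'.le⟩
    have : y = Q u := le_antisymm hyQ hy.1
    subst this
    linarith
  refine ⟨Q, hmono, hprop, ?_⟩
  rw [tendsto_order]
  refine ⟨fun a ha => ?_, fun a ha => ?_⟩
  · filter_upwards [self_mem_nhdsWithin] with u hu
    exact lt_of_lt_of_le ha (hprop u (le_of_lt hu)).1.1
  · obtain ⟨b, hb⟩ : ∃ b, b = min a h := ⟨_, rfl⟩
    have hb1 : -h < b := by rw [hb]; exact lt_min ha (by linarith)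
    have hbh : b ≤ h := hb ▸ min_le_right _ _
    obtain ⟨δ, hδ, hδ'⟩ : ∃ δ > 0, ∀ x ∈ Set.Icc b h, δ ≤ F x := by
      obtain ⟨z, hz, hz'⟩ := isCompact_Icc.exists_isMinOn (Set.nonempty_Icc.2 hbh) hF.continuousOn
      exact ⟨F z, hFpos z (hb1.trans_le hz.1) hz.2, fun x hx => hz' hx⟩
    have hc : Tendsto (fun u : ℝ => V * (1 - Real.exp (-u))) (𝓝[>] 0) (𝓝 0) := by
      have : Continuous fun u : ℝ => V * (1 - Real.exp (-u)) := by fun_prop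
      simpa using this.continuousWithinAt (s := Set.Ioi 0) (x := 0) |>.tendsto
    filter_upwards [hc.eventually_lt_const hδ, self_mem_nhdsWithin] with u hu hu0
    obtain ⟨hq, hq', -⟩ := hprop u (le_of_lt hu0)
    by_contra! hle
    have := hδ' (Q u) ⟨hb ▸ (min_le_left _ _).trans hle, hq.2⟩
    linarith

-- The two bounds, read on quantiles Q of F and R of H, show that increments of Q are at most the
-- preceding increments of R. Summing over a fine grid gives Q ≤ R, hence H ≤ F.
open Filter Topology in
theorem le_of_midpoint_sq_le {F H G : ℝ → ℝ} {h V : ℝ} (hh : 0 < h) (hV : 0 < V)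
    (hF : Continuous F) (hH : Continuous H) (hHm : Monotone H)
    (hF0 : F (-h) = 0) (hF1 : F h = V) (hH0 : H (-h) = 0) (hH1 : H h = V)
    (hG : StrictMonoOn G (Set.Icc (-h) h)) (hG0 : ∀ x, 0 ≤ G x) (hGV : ∀ x, G x ≤ V)
    (hlow : ∀ x ∈ Set.Icc (-h) h, ∀ y ∈ Set.Icc (-h) h, F x * H y ≤ G ((x + y) / 2) ^ 2)
    (hupp : ∀ x ∈ Set.Icc (-h) h, ∀ y ∈ Set.Icc (-h) h,
      (V - F x) * (V - H y) ≤ (V - G ((x + y) / 2)) ^ 2) :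
    ∀ x ∈ Set.Icc (-h) h, H x ≤ F x := by
  have hleft : -h ∈ Set.Icc (-h) h := ⟨le_rfl, by linarith⟩
  have hFpos : ∀ x, -h < x → x ≤ h → 0 < F x := by
    intro x hx hx'
    have h1 := hupp x ⟨hx.le, hx'⟩ (-h) hleft
    have h2 := hG hleft (⟨by linarith, by linarith⟩ : (x + -h) / 2 ∈ Set.Icc (-h) h) (by linarith)
    have h3 := hG0 (-h)
    have h4 := hGV ((x + -h) / 2)
    rw [hH0] at h1
    nlinarith
  have hHpos : ∀ x, -h < x → x ≤ h → 0 < H x := by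
    intro x hx hx'
    have h1 := hupp (-h) hleft x ⟨hx.le, hx'⟩
    have h2 := hG hleft (⟨by linarith, by linarith⟩ : (-h + x) / 2 ∈ Set.Icc (-h) h) (by linarith)
    have h3 := hG0 (-h)
    have h4 := hGV ((-h + x) / 2)
    rw [hF0] at h1
    nlinarith
  obtain ⟨Q, hQm, hQ, hQlim⟩ := exists_quantile hh hV hF hF0 hF1 hFpos
  obtain ⟨R, hRm, hR, hRlim⟩ := exists_quantile hh hV hH hH0 hH1 hHpos
  -- midpoint comparison of the quantiles
  have hmid : ∀ u v, 0 ≤ u → 0 ≤ v → Q u + R v ≤ Q ((u + v) / 2) + R ((u + v) / 2) := by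
    intro u v hu hv
    have huv : 0 ≤ (u + v) / 2 := by linarith
    obtain ⟨hq, hq1, -⟩ := hQ u hu
    obtain ⟨hr, hr1, -⟩ := hR v hv
    obtain ⟨hq', hq1', -⟩ := hQ _ huv
    obtain ⟨hr', hr1', -⟩ := hR _ huv
    have hexp : Real.exp (-u) * Real.exp (-v) = Real.exp (-((u + v) / 2)) ^ 2 := by
      rw [← Real.exp_add, sq, ← Real.exp_add]; ring_nf
    set E := Real.exp (-((u + v) / 2)) with hE
    have hE0 : 0 < E := Real.exp_pos _
    have hE1 : E ≤ 1 := Real.exp_le_one_iff.2 (by linarith)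
    -- `hupp` at (Q u, R v) bounds G there above by V(1 - E); `hlow` at the quantiles of (u + v)/2
    -- bounds G there below by the same number.
    have h1 := hupp _ hq _ hr
    have h2 := hlow _ hq' _ hr'
    rw [hq1, hr1] at h1
    rw [hq1', hr1'] at h2
    have h3 : (V * E) ^ 2 ≤ (V - G ((Q u + R v) / 2)) ^ 2 := by
      calc (V * E) ^ 2 = V ^ 2 * (Real.exp (-u) * Real.exp (-v)) := by rw [hexp]; ring
        _ = (V - V * (1 - Real.exp (-u))) * (V - V * (1 - Real.exp (-v))) := by ring
        _ ≤ _ := h1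
    have h4 := abs_le_of_sq_le_sq' h3 (by linarith [hGV ((Q u + R v) / 2)])
    have h5 := abs_le_of_sq_le_sq' (a := V * (1 - E)) (by linarith) (hG0 ((Q ((u + v) / 2) + R ((u + v) / 2)) / 2))
    have h6 : G ((Q u + R v) / 2) ≤ G ((Q ((u + v) / 2) + R ((u + v) / 2)) / 2) := by
      linarith [h4.2, h5.2]
    have h7 := (hG.le_iff_le ⟨by linarith [hq.1, hr.1], by linarith [hq.2, hr.2]⟩
      ⟨by linarith [hq'.1, hr'.1], by linarith [hq'.2, hr'.2]⟩).1 h6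
    linarith
  -- Telescoping of `hmid` at ((n + 2)ε, nε). The shift by one step vanishes as ε → 0, because Q ε →
  -- -h = R 0.
  have htel : ∀ (ε : ℝ), 0 ≤ ε → ∀ n : ℕ, Q ((n + 1) * ε) - Q ε ≤ R (n * ε) - R 0 := by
    intro ε hε n
    induction n with
    | zero => simp
    | succ n ih =>
      have h1 := hmid ((n + 2) * ε) (n * ε) (by positivity) (by positivity)
      have e1 : ((n + 2) * ε + n * ε) / 2 = (n + 1) * ε := by ring
      rw [e1] at h1
      push_cast
      have e2 : ((n : ℝ) + 1 + 1) * ε = (n + 2) * ε := by ring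
      rw [e2]
      linarith
  have hR0 : R 0 = -h := by
    obtain ⟨h1, h2, -⟩ := hR 0 le_rfl
    by_contra hne
    have := hHpos (R 0) (lt_of_le_of_ne h1.1 (Ne.symm hne)) h1.2
    simp at h2
    linarith
  have hQR : ∀ u, 0 < u → Q u ≤ R u := by
    intro u hu
    have hlim : Tendsto (fun n : ℕ => u / (n + 1 : ℝ)) atTop (𝓝[>] 0) := by
      refine tendsto_nhdsWithin_iff.2 ⟨?_, Eventually.of_forall fun n => ?_⟩
      · exact tendsto_const_div_atTop_nhds_zero_nat u |>.comp (tendsto_add_atTop_nat 1) |>.congr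
          fun n => by simp
      · exact Set.mem_Ioi.2 (by positivity)
    have hlim' := (hQlim.comp hlim).add_const (R u - R 0)
    refine (ge_of_tendsto' hlim' fun n => ?_).trans_eq (by rw [hR0]; ring)
    have h1 := htel (u / (n + 1 : ℝ)) (by positivity) (n + 1)
    push_cast at h1
    have e1 : ((n : ℝ) + 1) * (u / (n + 1)) = u := by field_simp
    have h2 : Q u ≤ Q (((n : ℝ) + 1 + 1) * (u / (n + 1))) := by
      refine hQm hu.le (Set.mem_Ici.2 (by positivity)) ?_
      rw [add_mul, e1]
      have : 0 ≤ 1 * (u / ((n : ℝ) + 1)) := by positivity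
      linarith
    rw [e1] at h1
    simp only [Function.comp_apply]
    linarith
  intro x hx
  rcases hx.1.eq_or_lt with rfl | hx0
  · rw [hF0, hH0]
  by_cases hFV : F x < V
  · have hFx := hFpos x hx0 hx.2
    set u := -Real.log (1 - F x / V) with hu
    have hlt : F x / V < 1 := (div_lt_one hV).2 hFV
    have hpos : 0 < F x / V := by positivity
    have hu0 : 0 < u := neg_pos.2 (Real.log_neg (by linarith) (by linarith))
    have hue : V * (1 - Real.exp (-u)) = F x := by
      rw [hu, neg_neg, Real.exp_log (by linarith)]
      field_simp
      ring
    have h1 : x ≤ Q u := (hQ u hu0.le).2.2 x hx hue.ge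
    have h2 := hHm (h1.trans (hQR u hu0))
    rwa [(hR u hu0.le).2.1, hue] at h2
  · exact (hHm hx.2).trans (hH1.trans_le (not_lt.1 hFV))

/-! ### Symmetry of measures on the line -/

theorem continuous_measureReal_Iic (μ : Measure ℝ) [IsFiniteMeasure μ] [NullSingletonClass μ] :
    Continuous fun x => μ.real (Set.Iic x) := by
  have h : ∀ x, μ.real (Set.Iic x) = μ.real (Set.Iic 0) + ∫ _ in (0 : ℝ)..x, (1 : ℝ) ∂μ := by
    intro x
    rw [← intervalIntegral.integral_Iic_sub_Iic (integrable_const _).integrableOn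
      (integrable_const _).integrableOn]
    simp
  rw [funext h]
  exact continuous_const.add
    (intervalIntegral.continuous_primitive (fun a b => intervalIntegrable_const) 0)

theorem measureReal_Ici_eq_sub (μ : Measure ℝ) [IsFiniteMeasure μ] [NullSingletonClass μ] (x : ℝ) :
    μ.real (Set.Ici x) = μ.real Set.univ - μ.real (Set.Iic x) := by
  rw [measureReal_congr (Ioi_ae_eq_Ici (μ := μ) (a := x)).symm, ← Set.compl_Iic,
    measureReal_compl measurableSet_Iic]

/-- A measure on `[-h, h]` dominated, in the multiplicative Brunn–Minkowski sense, by a measure of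
the same mass with full support in `[-h, h]` is symmetric. -/
theorem map_neg_eq_self_of_sq_le {μ σ : Measure ℝ} [IsFiniteMeasure μ] [NullSingletonClass μ]
    [IsFiniteMeasure σ] [NullSingletonClass σ] {h : ℝ} (hh : 0 < h)
    (hμ : μ (Set.Icc (-h) h)ᶜ = 0) (hμσ : μ Set.univ = σ Set.univ)
    (hpos : ∀ x y, -h ≤ x → x < y → y ≤ h → 0 < σ (Set.Ioc x y))
    (hlow : ∀ x y, μ (Set.Iic x) * μ (Set.Ici (-y)) ≤ σ (Set.Iic ((x + y) / 2)) ^ 2)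
    (hupp : ∀ x y, μ (Set.Ici x) * μ (Set.Iic (-y)) ≤ σ (Set.Ici ((x + y) / 2)) ^ 2) :
    μ.map (fun x => -x) = μ := by
  have toR : ∀ {a b c : ℝ≥0∞}, c ≠ ∞ → a * b ≤ c ^ 2 → a.toReal * b.toReal ≤ c.toReal ^ 2 := by
    intro a b c hc hab
    rw [← ENNReal.toReal_mul, ← ENNReal.toReal_pow]
    exact ENNReal.toReal_mono (ENNReal.pow_ne_top hc) hab
  set V := μ.real Set.univ with hV
  have hVσ : σ.real Set.univ = V := by rw [hV, measureReal_def, measureReal_def, hμσ]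
  have hV0 : 0 < V := by
    rw [← hVσ]
    refine ENNReal.toReal_pos ?_ (measure_ne_top _ _)
    exact ((hpos (-h) h le_rfl (by linarith) le_rfl).trans_le (measure_mono (Set.subset_univ _))).ne'
  have hIic : ∀ x, x ≤ -h → μ (Set.Iic x) = 0 := by
    intro x hx
    rw [← measure_congr (Iio_ae_eq_Iic (μ := μ) (a := x))]
    exact measure_mono_null (t := (Set.Icc (-h) h)ᶜ)
      (fun y hy (hy' : y ∈ Set.Icc (-h) h) => absurd (hx.trans hy'.1) (not_le.2 hy)) hμ
  have hIci : ∀ x, h ≤ x → μ (Set.Ici x) = 0 := by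
    intro x hx
    rw [← measure_congr (Ioi_ae_eq_Ici (μ := μ) (a := x))]
    exact measure_mono_null (t := (Set.Icc (-h) h)ᶜ)
      (fun y hy (hy' : y ∈ Set.Icc (-h) h) => absurd (hy'.2.trans hx) (not_le.2 hy)) hμ
  set F : ℝ → ℝ := fun x => μ.real (Set.Iic x) with hF
  -- The distribution function of the reflected measure. The bounds are symmetric in F and H, so the
  -- comparison applies in both directions.
  set H : ℝ → ℝ := fun x => μ.real (Set.Ici (-x)) with hH
  have hH' : ∀ x, H x = V - F (-x) := fun x => measureReal_Ici_eq_sub μ (-x)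
  have hFc : Continuous F := continuous_measureReal_Iic μ
  have hHc : Continuous H := by
    rw [funext hH']
    exact continuous_const.sub (hFc.comp continuous_neg)
  have hFm : Monotone F := fun x y hxy => measureReal_mono (Set.Iic_subset_Iic.2 hxy)
  have hHm : Monotone H := fun x y hxy => measureReal_mono (Set.Ici_subset_Ici.2 (neg_le_neg hxy))
  have hF0 : ∀ x, x ≤ -h → F x = 0 := fun x hx => by simp [hF, measureReal_def, hIic x hx]
  have hH0 : ∀ x, x ≤ -h → H x = 0 := fun x hx => by
    simp [hH, measureReal_def, hIci (-x) (by linarith)]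
  have hF1 : ∀ x, h ≤ x → F x = V := fun x hx => by
    have := hH0 (-x) (by linarith)
    rw [hH', neg_neg] at this
    linarith
  have hH1 : ∀ x, h ≤ x → H x = V := fun x hx => by
    rw [hH', hF0 _ (by linarith), sub_zero]
  have hGm : StrictMonoOn (fun x => σ.real (Set.Iic x)) (Set.Icc (-h) h) := by
    intro x hx y hy hxy
    have h1 := ENNReal.toReal_pos (hpos x y hx.1 hxy hy.2).ne' (measure_ne_top _ _)
    have h2 : σ.real (Set.Iic y) = σ.real (Set.Iic x) + σ.real (Set.Ioc x y) := by
      rw [← Set.Iic_union_Ioc_eq_Iic hxy.le,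
        measureReal_union (Set.Iic_disjoint_Ioc le_rfl) measurableSet_Ioc]
    rw [← measureReal_def] at h1
    change σ.real (Set.Iic x) < σ.real (Set.Iic y)
    linarith
  have hG0 : ∀ x, 0 ≤ σ.real (Set.Iic x) := fun x => measureReal_nonneg
  have hGV : ∀ x, σ.real (Set.Iic x) ≤ V := fun x =>
    hVσ ▸ measureReal_mono (Set.subset_univ _)
  have hl : ∀ x y, F x * H y ≤ σ.real (Set.Iic ((x + y) / 2)) ^ 2 := fun x y =>
    toR (measure_ne_top _ _) (hlow x y)
  have hu : ∀ x y, (V - F x) * (V - H y) ≤ (V - σ.real (Set.Iic ((x + y) / 2))) ^ 2 := fun x y => by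
    rw [hH', sub_sub_cancel, ← measureReal_Ici_eq_sub, ← hVσ, ← measureReal_Ici_eq_sub]
    exact toR (measure_ne_top _ _) (hupp x y)
  have h1 := le_of_midpoint_sq_le hh hV0 hFc hHc hHm (hF0 _ le_rfl) (hF1 _ le_rfl) (hH0 _ le_rfl)
    (hH1 _ le_rfl) hGm hG0 hGV (fun x _ y _ => hl x y) (fun x _ y _ => hu x y)
  have h2 := le_of_midpoint_sq_le hh hV0 hHc hFc hFm (hH0 _ le_rfl) (hH1 _ le_rfl) (hF0 _ le_rfl)
    (hF1 _ le_rfl) hGm hG0 hGV (fun x _ y _ => by rw [mul_comm, add_comm]; exact hl y x)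
    (fun x _ y _ => by rw [mul_comm, add_comm]; exact hu y x)
  have hFH : ∀ x, F x = H x := by
    intro x
    rcases le_total x (-h) with hx | hx
    · rw [hF0 x hx, hH0 x hx]
    rcases le_total x h with hx' | hx'
    · exact le_antisymm (h2 x ⟨hx, hx'⟩) (h1 x ⟨hx, hx'⟩)
    · rw [hF1 x hx', hH1 x hx']
  refine (Measure.ext_of_Iic _ _ fun a => ?_).symm
  rw [Measure.map_apply measurable_neg measurableSet_Iic]
  have e : (fun x : ℝ => -x) ⁻¹' Set.Iic a = Set.Ici (-a) := by ext; simp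
  rw [e]
  exact (ENNReal.toReal_eq_toReal_iff' (measure_ne_top _ _) (measure_ne_top _ _)).1 (hFH a)

theorem integral_id_eq_zero_of_map_neg {μ : Measure ℝ} (h : μ.map (fun x => -x) = μ) :
    ∫ x, x ∂μ = 0 := by
  have h1 : ∫ x, x ∂μ = ∫ x, -x ∂μ := by
    conv_lhs => rw [← h]
    exact integral_map (by fun_prop) (by fun_prop)
  rw [integral_neg] at h1
  linarith

theorem LinearMap.addHaar_fiber_eq_zero {E : Type*} [NormedAddCommGroup E] [NormedSpace ℝ E]
    [MeasurableSpace E] [BorelSpace E] [FiniteDimensional ℝ E] (μ : Measure E) [μ.IsAddHaarMeasure]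
    {f : E →ₗ[ℝ] ℝ} (hf : Function.Surjective f) (c : ℝ) : μ {y | f y = c} = 0 := by
  obtain ⟨w, hw⟩ := hf c
  have e : {y | f y = c} = (fun y => y + -w) ⁻¹' (LinearMap.ker f : Set E) := by
    ext y
    simp [← sub_eq_add_neg, hw, sub_eq_zero]
  rw [e, measure_preimage_add_right]
  refine Measure.addHaar_submodule μ _ fun htop => ?_
  obtain ⟨z, hz⟩ := hf 1
  have : z ∈ LinearMap.ker f := htop ▸ Submodule.mem_top
  rw [LinearMap.mem_ker, hz] at this
  exact one_ne_zero this

/-! ### Intersections of slabs and the equality case -/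

section Slabs

variable {M N : ℕ} (L : Fin M → (EuclideanSpace ℝ (Fin N) →ₗ[ℝ] ℝ)) (l t : Fin M → ℝ)

/-- The intersection of the slabs `|L i y - t i| ≤ l i / 2`. -/
def slabInter : Set (EuclideanSpace ℝ (Fin N)) := {y | ∀ i, |L i y - t i| ≤ l i / 2}

theorem measurableSet_slabInter : MeasurableSet (slabInter L l t) := by
  have : slabInter L l t = ⋂ i, {y | |L i y - t i| ≤ l i / 2} := by
    ext; simp [slabInter]
  rw [this]
  refine MeasurableSet.iInter fun i => (isClosed_le ?_ continuous_const).measurableSet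
  exact ((L i).continuous_of_finiteDimensional.sub continuous_const).abs

theorem mem_translateSet_centeredInterval {a s x : ℝ} :
    x ∈ translateSet (centeredInterval a) s ↔ |x - s| ≤ a / 2 := by
  rw [abs_le]
  constructor
  · rintro ⟨y, hy, rfl⟩
    simpa [centeredInterval] using hy
  · exact fun h => ⟨x - s, h, by simp⟩

theorem Psi_eq_volume_slabInter : Psi L l t = volume (slabInter L l t) := by
  rw [Psi, ← lintegral_indicator_one (measurableSet_slabInter L l t)]
  refine lintegral_congr fun y => ?_
  by_cases hy : y ∈ slabInter L l t
  · rw [Set.indicator_of_mem hy]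
    exact Finset.prod_eq_one fun i _ =>
      Set.indicator_of_mem (mem_translateSet_centeredInterval.2 (hy i)) _
  · rw [Set.indicator_of_notMem hy]
    simp only [slabInter, Set.mem_ofPred_eq, not_forall] at hy
    obtain ⟨i, hi⟩ := hy
    exact Finset.prod_eq_zero (Finset.mem_univ i)
      (Set.indicator_of_notMem (fun h => hi (mem_translateSet_centeredInterval.1 h)) _)

variable {L l t}

theorem half_sub_mem_slabInter {x y : EuclideanSpace ℝ (Fin N)} (hx : x ∈ slabInter L l t)
    (hy : y ∈ slabInter L l t) : (2⁻¹ : ℝ) • (x - y) ∈ slabInter L l 0 := by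
  intro i
  have h1 := abs_le.1 (hx i)
  have h2 := abs_le.1 (hy i)
  rw [map_smul, map_sub, smul_eq_mul, Pi.zero_apply, sub_zero, abs_le]
  constructor <;> linarith

theorem volume_slabInter_eq_of_translate {v : EuclideanSpace ℝ (Fin N)} (hv : ∀ i, L i v = t i) :
    volume (slabInter L l t) = volume (slabInter L l 0) := by
  rw [← measure_preimage_add_right volume (-v) (slabInter L l 0)]
  congr 1
  ext y
  simp [slabInter, hv, sub_eq_add_neg]

theorem volume_slabInter_le : volume (slabInter L l t) ≤ volume (slabInter L l 0) := by
  have h := EuclideanSpace.volume_mul_le_of_half_sub_mem (measurableSet_slabInter L l t)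
    (measurableSet_slabInter L l t) (measurableSet_slabInter L l 0)
    fun x hx y hy => half_sub_mem_slabInter hx hy
  rwa [← sq, ENNReal.pow_le_pow_left_iff two_ne_zero] at h

/-- A multiple of the admissibility witness for m has L_m-value (x + y)/2. As |(x + y)/2| < l_m/2,
it satisfies every slab condition strictly, so an open neighbourhood is contained in the set. -/
theorem volume_slabInter_inter_pos (hl : ∀ i, 0 < l i) (hadm : IsAdmissibleTuple L l) (m : Fin M)
    {x y : ℝ} (hx : -(l m / 2) ≤ x) (hxy : x < y) (hy : y ≤ l m / 2) :
    0 < volume (slabInter L l 0 ∩ {z | L m z ∈ Set.Ioc x y}) := by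
  have hc : ∀ i, Continuous (L i) := fun i => (L i).continuous_of_finiteDimensional
  set U : Set (EuclideanSpace ℝ (Fin N)) :=
    (⋂ i, {z | |L i z| < l i / 2}) ∩ (L m ⁻¹' Set.Ioo x y) with hU
  have hUo : IsOpen U :=
    (isOpen_iInter_of_finite fun i => isOpen_lt (hc i).abs continuous_const).inter
      (isOpen_Ioo.preimage (hc m))
  obtain ⟨z, hz, hzm⟩ := hadm m
  have hlm := hl m
  have hne : L m z ≠ 0 := abs_pos.1 (hzm ▸ hlm)
  have hUn : U.Nonempty := by
    refine ⟨((x + y) / 2 / L m z) • z, Set.mem_iInter.2 fun i => ?_, ?_⟩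
    · have h1 : |(x + y) / 2| < l m / 2 := abs_lt.2 ⟨by linarith, by linarith⟩
      rw [Set.mem_ofPred_eq, map_smul, smul_eq_mul, abs_mul, abs_div, hzm]
      calc |(x + y) / 2| / l m * |L i z| ≤ |(x + y) / 2| / l m * l i := by
            gcongr
            exact hz i
        _ < (l m / 2) / l m * l i := by
            gcongr
            exact hl i
        _ = l i / 2 := by field_simp
    · rw [Set.mem_preimage, map_smul, smul_eq_mul, div_mul_cancel₀ _ hne]
      exact ⟨by linarith, by linarith⟩
  refine (hUo.measure_pos volume hUn).trans_le (measure_mono ?_)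
  rintro w ⟨hw, hw'⟩
  refine ⟨fun i => ?_, Set.Ioo_subset_Ioc_self hw'⟩
  have := Set.mem_iInter.1 hw i
  simpa using le_of_lt this

theorem integral_slabInter_eq_zero (hL : ∀ i, Function.Surjective (L i)) (hl : ∀ i, 0 < l i)
    (hadm : IsAdmissibleTuple L l) (hfin : volume (slabInter L l 0) < ∞)
    (heq : volume (slabInter L l t) = volume (slabInter L l 0)) (m : Fin M) :
    ∫ y in slabInter L l t, (L m y - t m) = 0 := by
  have hcont : ∀ i, Continuous (L i) := fun i => (L i).continuous_of_finiteDimensional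
  have hmt : Measurable fun y => L m y - t m := ((hcont m).sub continuous_const).measurable
  have hm0 : Measurable (L m) := (hcont m).measurable
  have hSt := measurableSet_slabInter L l t
  have hS0 := measurableSet_slabInter L l 0
  have : IsFiniteMeasure (volume.restrict (slabInter L l t)) :=
    isFiniteMeasure_restrict.2 (heq ▸ hfin).ne
  have : IsFiniteMeasure (volume.restrict (slabInter L l 0)) := isFiniteMeasure_restrict.2 hfin.ne
  set μ : Measure ℝ := (volume.restrict (slabInter L l t)).map fun y => L m y - t m with hμ
  set σ : Measure ℝ := (volume.restrict (slabInter L l 0)).map (L m) with hσ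
  have hμa : ∀ s, MeasurableSet s →
      μ s = volume ((fun y => L m y - t m) ⁻¹' s ∩ slabInter L l t) := fun s hs => by
    rw [hμ, Measure.map_apply hmt hs, Measure.restrict_apply (hmt hs)]
  have hσa : ∀ s, MeasurableSet s → σ s = volume (L m ⁻¹' s ∩ slabInter L l 0) := fun s hs => by
    rw [hσ, Measure.map_apply hm0 hs, Measure.restrict_apply (hm0 hs)]
  have : NullSingletonClass μ := ⟨fun c => by
    rw [hμa _ (measurableSet_singleton c)]
    refine measure_mono_null ?_ (LinearMap.addHaar_fiber_eq_zero volume (hL m) (c + t m))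
    rintro y ⟨hy, -⟩
    exact sub_eq_iff_eq_add.1 hy⟩
  have : NullSingletonClass σ := ⟨fun c => by
    rw [hσa _ (measurableSet_singleton c)]
    exact measure_mono_null (fun y hy => hy.1) (LinearMap.addHaar_fiber_eq_zero volume (hL m) c)⟩
  have hbm : ∀ s s' r : Set ℝ, MeasurableSet s → MeasurableSet s' → MeasurableSet r →
      (∀ a ∈ s, ∀ b ∈ s', (a - b) / 2 ∈ r) → μ s * μ s' ≤ σ r ^ 2 := by
    intro s s' r hs hs' hr H
    rw [hμa s hs, hμa s' hs', hσa r hr]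
    refine EuclideanSpace.volume_mul_le_of_half_sub_mem ((hmt hs).inter hSt) ((hmt hs').inter hSt)
      ((hm0 hr).inter hS0) ?_
    rintro x ⟨hx, hx'⟩ y ⟨hy, hy'⟩
    refine ⟨?_, half_sub_mem_slabInter hx' hy'⟩
    have h1 := H _ hx _ hy
    rw [Set.mem_preimage, map_smul, map_sub, smul_eq_mul]
    convert h1 using 1
    ring
  have hsymm : μ.map (fun x => -x) = μ := by
    refine map_neg_eq_self_of_sq_le (σ := σ) (half_pos (hl m)) ?_ ?_ ?_ ?_ ?_
    · rw [hμa _ measurableSet_Icc.compl]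
      convert measure_empty (μ := volume) using 2
      rw [Set.eq_empty_iff_forall_notMem]
      rintro y ⟨hy, hy'⟩
      exact hy (abs_le.1 (hy' m))
    · rw [hμa _ .univ, hσa _ .univ]
      simpa using heq
    · intro x y hx hxy hy
      rw [hσa _ measurableSet_Ioc, Set.inter_comm]
      exact volume_slabInter_inter_pos hl hadm m hx hxy hy
    · intro x y
      refine hbm _ _ _ measurableSet_Iic measurableSet_Ici measurableSet_Iic fun a ha b hb => ?_
      simp only [Set.mem_Iic, Set.mem_Ici] at *
      linarith
    · intro x y
      refine hbm _ _ _ measurableSet_Ici measurableSet_Iic measurableSet_Ici fun a ha b hb => ?_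
      simp only [Set.mem_Iic, Set.mem_Ici] at *
      linarith
  have := integral_id_eq_zero_of_map_neg hsymm
  rwa [hμ, integral_map hmt.aemeasurable (by fun_prop)] at this

theorem exists_forall_eq_of_volume_slabInter_eq (hM : 0 < M) (hL : ∀ i, Function.Surjective (L i))
    (hl : ∀ i, 0 < l i) (hadm : IsAdmissibleTuple L l) (hfin : volume (slabInter L l 0) < ∞)
    (heq : volume (slabInter L l t) = volume (slabInter L l 0)) : ∃ v, ∀ i, L i v = t i := by
  have hpos : 0 < volume (slabInter L l 0) := by
    have hm := hl ⟨0, hM⟩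
    exact (volume_slabInter_inter_pos hl hadm ⟨0, hM⟩ le_rfl (by linarith) le_rfl).trans_le
      (measure_mono Set.inter_subset_left)
  set μ := volume.restrict (slabInter L l t) with hμ
  have : IsFiniteMeasure μ := isFiniteMeasure_restrict.2 (heq ▸ hfin).ne
  have : NeZero μ := ⟨by rw [hμ, Ne, Measure.restrict_eq_zero, heq]; exact hpos.ne'⟩
  have hcont : ∀ i, Continuous (L i) := fun i => (L i).continuous_of_finiteDimensional
  have hint : ∀ i, Integrable (fun y => L i y - t i) μ := fun i => by
    refine Integrable.of_bound ((hcont i).sub continuous_const).aestronglyMeasurable (l i / 2) ?_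
    exact (ae_restrict_mem (measurableSet_slabInter L l t)).mono fun y hy => hy i
  have hint' : ∀ i, Integrable (fun y => LinearMap.pi L y i) μ := fun i => by
    exact ((hint i).add (integrable_const (t i))).congr
      (Filter.Eventually.of_forall fun y => sub_add_cancel (L i y) (t i))
  -- Averaging in ℝ^M needs only integrability of each L_i, and a finite-dimensional subspace is
  -- closed and convex, so it contains the average.
  obtain ⟨v, hv⟩ : ⨍ y, LinearMap.pi L y ∂μ ∈ (LinearMap.range (LinearMap.pi L) : Set (Fin M → ℝ)) :=
    Convex.average_mem (LinearMap.range (LinearMap.pi L)).convex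
      (Submodule.closed_of_finiteDimensional _)
      (Filter.Eventually.of_forall fun y => ⟨y, rfl⟩) (Integrable.of_eval hint')
  refine ⟨v, fun i => ?_⟩
  have h1 := congrFun hv i
  have h2 := integral_slabInter_eq_zero hL hl hadm hfin heq i
  rw [integral_sub (by simpa using hint' i) (integrable_const _), sub_eq_zero, integral_const,
    smul_eq_mul] at h2
  rw [average_eq, Pi.smul_apply, eval_integral hint', smul_eq_mul] at h1
  simp only [LinearMap.pi_apply] at h1
  rw [h1, h2, inv_mul_cancel_left₀]
  exact measureReal_univ_ne_zero

end Slabs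

theorem lemma7p5 {M N : ℕ} (hM : 0 < M) (hN : 0 < N)
    (L : Fin M → (EuclideanSpace ℝ (Fin N) →ₗ[ℝ] ℝ)) (l : Fin M → ℝ)
    (hL : ∀ i, Function.Surjective (L i)) (hl : ∀ i, 0 < l i)
    (hadm : IsAdmissibleTuple L l) (t : Fin M → ℝ) :
    Psi L l t ≤ Psi L l 0 ∧
      (Psi L l 0 < ∞ → (Psi L l t = Psi L l 0 ↔ ∃ v, ∀ i, L i v = t i)) ∧
      ((∃ v, ∀ i, L i v = t i) → Psi L l t = Psi L l 0) := by
  rw [Psi_eq_volume_slabInter, Psi_eq_volume_slabInter]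
  exact ⟨volume_slabInter_le,
    fun hfin => ⟨exists_forall_eq_of_volume_slabInter_eq hM hL hl hadm hfin,
      fun ⟨_, hv⟩ => volume_slabInter_eq_of_translate hv⟩,
    fun ⟨_, hv⟩ => volume_slabInter_eq_of_translate hv⟩
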